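/- Let $\mathbb H$ be the upper half plane with coordinate $\tau$, and let $\mathcal O(\mathbb H)$ be the ring of holomorphic functions on $\mathbb H$. Let $V=\mathbb C[b_0][a_{-1},a_{-2},\dots,b_{-1},b_{-2},\dots]$ be the vacuum representation of the Heisenberg Lie algebra $[a_m,b_n]=\delta_{m,-n}$ (with $a_m1=0$ for $m\ge 0$ and $b_n1=0$ for $n>0$), and let $$\mathscr D^{ch}(\mathbb H)=V\otimes_{\mathbb C[b_0]}\mathcal O(\mathbb H),\qquad b_0\mapsto\tau .$$ Every element is a finite sum of elements $a_{-\lambda}b_{-\mu}f(b)$ with $\lambda,\mu$ partitions, $a_{-\lambda}=a_{-\lambda_1}a_{-\lambda_2}\cdots$, $b_{-\mu}=b_{-\mu_1}b_{-\mu_2}\cdots$, and $f\in\mathcal O(\mathbb H)$. Here $a_{-\lambda}b_{-\mu}f(b)$ has conformal weight $|\lambda|+|\mu|$, the operator $a_0$ acts on coefficients as $d/d\tau$, and for $n>0$ the operators $a_n$ and $b_n$ act as $\partial/\partial b_{-n}$ and $-\partial/\partial a_{-n}$. For $f\in\mathcal O(\mathbb H)$ let $f(b)_m$ be the coefficient of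 $z^{-m}$ in $$Y(f,z)=\sum_{i\ge 0}\frac{\partial^i f(b)}{i!}\Big(\sum_{n\ne 0}b_nz^{-n}\Big)^i .$$ For $g=\begin{pmatrix}\alpha&\beta\\ \gamma&\delta\end{pmatrix}\in SL(2,\mathbb R)$ put $$\pi(g)\,a_{-\lambda}b_{-\mu}f(b)=(\pi(g)a)_{-\lambda_1}(\pi(g)a)_{-\lambda_2}\cdots(\pi(g)b)_{-\mu_1}(\pi(g)b)_{-\mu_2}\cdots f(gb),$$ where $(\pi(g)b)_{n}=h(b)_n$ with $h(\tau)=\frac{\alpha\tau+\beta}{\gamma\tau+\delta}$, and $(\pi(g)a)_n$ is the $n$-th mode (the coefficient of $z^{-n-1}$ of the field) of $a_{-1}(\gamma b+\delta)^2+2\gamma^2b_{-1}$; that is, with $k(\tau)=(\gamma\tau+\delta)^2$, $$(\pi(g)a)_n=\sum_{j\ge 1}a_{-j}\,k(b)_{n+j}+\sum_{j\ge 0}k(b)_{n-j}\,a_j-2n\gamma^2b_n .$$ For a subgroup $\Gamma\subset SL(2,\mathbb Z)$, let $\mathscr D^{ch}(\mathbb H,\Gamma)$ be the space of all $v\in\mathscr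 D^{ch}(\mathbb H)$ with $\pi(g)v=v$ for all $g\in\Gamma$ that are holomorphic at every cusp $c\in\mathbb Q\cup\{\infty\}$. The latter means: for $\rho\in SL(2,\mathbb Z)$ with $\rho(\infty)=c$, each coefficient $\tilde f_{\lambda,\mu}$ of $\pi(\rho)v=\sum a_{-\lambda}b_{-\mu}\tilde f_{\lambda,\mu}(b)$ has, for some positive integer $h$, a Fourier expansion $\tilde f_{\lambda,\mu}(\tau)=\sum_{m}u(m)e^{2\pi i m\tau/h}$ with $u(m)=0$ for all $m<0$. Let $\mathscr D^{ch}(\mathbb H,\Gamma)_N$ be its subspace of elements of conformal weight $N$. Proposition. For every congruence subgroup $\Gamma\subset SL(2,\mathbb Z)$ and every integer $N\ge 0$, $$\dim_{\mathbb C}\mathscr D^{ch}(\mathbb H,\Gamma)_N<\infty .$$ -/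

import Mathlib

open scoped MatrixGroups

noncomputable section

namespace ChiralDiffOp

open UpperHalfPlane MvPolynomial
open scoped Manifold TensorProduct

/-! ### Holomorphic functions on the upper half plane -/

/-- The holomorphic functions on the upper half plane, as a subalgebra of all functions. -/
def holSubalgebra : Subalgebra ℂ (ℍ → ℂ) where
  carrier := {f | MDifferentiable 𝓘(ℂ) 𝓘(ℂ) f}
  mul_mem' hf hg := hf.mul hg
  add_mem' hf hg := hf.add hg
  algebraMap_mem' _ := mdifferentiable_const

/-- The ring `𝒪(ℍ)` of holomorphic functions on the upper half plane. -/
def Hol : Type := holSubalgebra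

instance : CommRing Hol := inferInstanceAs (CommRing holSubalgebra)

instance : Algebra ℂ Hol := inferInstanceAs (Algebra ℂ holSubalgebra)

instance : CoeFun Hol fun _ => ℍ → ℂ := ⟨fun f => f.1⟩

namespace Hol

theorem ext {f g : Hol} (h : ∀ z, f z = g z) : f = g := Subtype.ext (funext h)

theorem add_apply (f g : Hol) (z : ℍ) : (f + g) z = f z + g z := rfl

theorem mul_apply (f g : Hol) (z : ℍ) : (f * g) z = f z * g z := rfl

theorem smul_apply (c : ℂ) (f : Hol) (z : ℍ) : (c • f) z = c * f z := rfl

theorem zero_apply (z : ℍ) : (0 : Hol) z = 0 := rfl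

theorem mdifferentiable (f : Hol) : MDifferentiable 𝓘(ℂ) 𝓘(ℂ) (f : ℍ → ℂ) := f.2

end Hol

/-- The coordinate function `τ`. -/
def tau : Hol := ⟨fun z => (z : ℂ), mdifferentiable_coe⟩

theorem mdifferentiable_deriv (f : Hol) :
    MDifferentiable 𝓘(ℂ) 𝓘(ℂ) fun z : ℍ => deriv ((f : ℍ → ℂ) ∘ ofComplex) z := by
  rw [UpperHalfPlane.mdifferentiable_iff]
  have hf := UpperHalfPlane.mdifferentiable_iff.mp f.mdifferentiable
  refine (hf.deriv isOpen_upperHalfPlaneSet).congr fun z hz => ?_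
  simp [Function.comp_apply, ofComplex_apply_of_im_pos hz]

/-- The complex derivative `∂ = d/dτ` on `𝒪(ℍ)`. -/
def dTau : Hol →ₗ[ℂ] Hol where
  toFun f := ⟨fun z => deriv ((f : ℍ → ℂ) ∘ ofComplex) z, mdifferentiable_deriv f⟩
  map_add' f g := Hol.ext fun z =>
    deriv_add (UpperHalfPlane.mdifferentiableAt_iff.mp (f.mdifferentiable z))
      (UpperHalfPlane.mdifferentiableAt_iff.mp (g.mdifferentiable z))
  map_smul' c f := Hol.ext fun z =>
    deriv_const_smul c (UpperHalfPlane.mdifferentiableAt_iff.mp (f.mdifferentiable z))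

/-- For `g = (α β; γ δ) ∈ SL(2, ℝ)`, the function `τ ↦ γ τ + δ`. -/
def den (g : SL(2, ℝ)) : Hol :=
  ⟨fun z => denom (g : GL (Fin 2) ℝ) z, mdifferentiable_denom _⟩

/-- For `g ∈ SL(2, ℝ)`, the substitution `f(τ) ↦ f(gτ)`. -/
def subst (g : SL(2, ℝ)) : Hol →ₗ[ℂ] Hol where
  toFun f := ⟨fun z => f ((g : GL (Fin 2) ℝ) • z),
    f.mdifferentiable.comp (mdifferentiable_smul (by simp))⟩
  map_add' _ _ := rfl
  map_smul' _ _ := rfl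

/-! ### The space of chiral differential operators and the Heisenberg action -/

/-- Index set of the creation operators: `Sum.inl n` stands for `a_{-n}` and `Sum.inr n` for
`b_{-n}`, `n ≥ 1`. -/
abbrev Gen : Type := ℕ+ ⊕ ℕ+

/-- The space `𝒟^ch(ℍ) = V ⊗_{ℂ[b₀]} 𝒪(ℍ)`, where
`V = ℂ[b₀][a_{-1}, a_{-2}, …, b_{-1}, b_{-2}, …]`, realised as the polynomial ring
`𝒪(ℍ)[a_{-1}, a_{-2}, …, b_{-1}, b_{-2}, …]`. -/
abbrev Dch : Type := MvPolynomial Gen Hol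

/-- The identification of `V ⊗_{ℂ[b₀]} 𝒪(ℍ)` with `Dch`, where `ℂ[b₀] → 𝒪(ℍ)` maps `b₀` to
`τ`. -/
def tensorEquiv :
    letI : Algebra (Polynomial ℂ) Hol := (Polynomial.aeval tau).toAlgebra
    Hol ⊗[Polynomial ℂ] MvPolynomial Gen (Polynomial ℂ) ≃ₐ[Hol] Dch :=
  letI : Algebra (Polynomial ℂ) Hol := (Polynomial.aeval tau).toAlgebra
  MvPolynomial.algebraTensorAlgEquiv (Polynomial ℂ) Hol

/-- The `ℂ`-linear map `Dch → Dch` which sends `x^m f` to `φ m f`, for each monomial `x^m` in the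
variables `a_{-n}, b_{-n}` and each `f ∈ 𝒪(ℍ)`. -/
def ofMonomials (φ : (Gen →₀ ℕ) → Hol →ₗ[ℂ] Dch) : Module.End ℂ Dch :=
  Finsupp.lsum ℂ φ ∘ₗ (AddMonoidAlgebra.coeffLinearEquiv ℂ).toLinearMap

theorem ofMonomials_monomial (φ : (Gen →₀ ℕ) → Hol →ₗ[ℂ] Dch) (m : Gen →₀ ℕ) (f : Hol) :
    ofMonomials φ (monomial m f) = φ m f :=
  Finsupp.lsum_single (S := ℂ) φ m f

/-- Multiplication by an element of `Dch`. -/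
def mulBy (p : Dch) : Module.End ℂ Dch := LinearMap.mulLeft ℂ p

/-- The operator `a_n` on `Dch`. From `[a_m, b_n] = δ_{m,-n}`, the operator `a_n` with `n > 0` acts
as `∂/∂b_{-n}`, and `a_0` acts as `d/dτ` on the coefficients. -/
def a : ℤ → Module.End ℂ Dch
  | .ofNat 0 => ofMonomials fun m => (monomial m).restrictScalars ℂ ∘ₗ dTau
  | .ofNat (n + 1) => (pderiv (Sum.inr n.succPNat)).toLinearMap.restrictScalars ℂ
  | .negSucc n => mulBy (X (Sum.inl n.succPNat))

/-- The operator `b_n` on `Dch`. From `[a_m, b_n] = δ_{m,-n}`, the operator `b_n` with `n > 0` acts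
as `-∂/∂a_{-n}`, and `b_0` is multiplication by `τ`. -/
def b : ℤ → Module.End ℂ Dch
  | .ofNat 0 => mulBy (C tau)
  | .ofNat (n + 1) => -(pderiv (Sum.inl n.succPNat)).toLinearMap.restrictScalars ℂ
  | .negSucc n => mulBy (X (Sum.inr n.succPNat))

/-! ### Locally finite sums of operators -/

/-- The sum of a family of operators of which only finitely many are nonzero on each given
vector. -/
def locFinSum {ι : Type} (T : ι → Module.End ℂ Dch)
    (hT : ∀ v, (Function.support fun i => T i v).Finite) : Module.End ℂ Dch where
  toFun v := ∑ᶠ i, T i v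
  map_add' v w := by
    simp only [map_add]
    exact finsum_add_distrib (hT v) (hT w)
  map_smul' c v := by
    simp only [map_smul, RingHom.id_apply]
    exact (smul_finsum' c (hT v)).symm

/-- `Σ n · (multiplicity of a_{-n})`, for a monomial. -/
def aWt (m : Gen →₀ ℕ) : ℕ :=
  Finsupp.weight (Sum.elim (fun n : ℕ+ => (n : ℕ)) fun _ => 0) m

/-- All monomials of `v` satisfy `aWt ≤ w`. -/
def AWtLE (w : ℤ) (v : Dch) : Prop := ∀ m, coeff m v ≠ 0 → (aWt m : ℤ) ≤ w

theorem AWtLE.exists (v : Dch) : ∃ w : ℕ, AWtLE w v := by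
  refine ⟨v.support.sup aWt, fun m hm => ?_⟩
  exact_mod_cast Finset.le_sup (f := aWt) (mem_support_iff.mpr hm)

theorem AWtLE.eq_zero {w : ℤ} {v : Dch} (h : AWtLE w v) (hw : w < 0) : v = 0 := by
  ext1 m
  by_contra hm
  have := h m hm
  omega

theorem aWt_add_single (m : Gen →₀ ℕ) (i : Gen) :
    aWt (m + Finsupp.single i 1) = aWt m + Sum.elim (fun n : ℕ+ => (n : ℕ)) (fun _ => 0) i := by
  simp [aWt, Finsupp.weight_single]

theorem AWtLE.b {w : ℤ} {v : Dch} (h : AWtLE w v) (n : ℤ) (hn : n ≠ 0) :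
    AWtLE (w - max n 0) (b n v) := by
  classical
  match n, hn with
  | .ofNat (n + 1), _ =>
    intro m hm
    have hm' : coeff (m + Finsupp.single (Sum.inl n.succPNat) 1) v ≠ 0 := by
      intro h0
      apply hm
      change coeff m (-(pderiv (Sum.inl n.succPNat) v)) = 0
      rw [coeff_neg, coeff_pderiv, h0]
      simp
    have := h _ hm'
    rw [aWt_add_single] at this
    simp at this ⊢
    omega
  | .negSucc n, _ =>
    intro m hm
    change coeff m (X (Sum.inr n.succPNat) * v) ≠ 0 at hm
    rw [coeff_X_mul'] at hm
    split_ifs at hm with hs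
    · have h1 := h _ hm
      have h2 : m = (m - Finsupp.single (Sum.inr n.succPNat) 1)
          + Finsupp.single (Sum.inr n.succPNat) 1 := by
        rw [tsub_add_cancel_of_le]
        simpa [Nat.one_le_iff_ne_zero] using hs
      rw [h2, aWt_add_single]
      have h3 : max (Int.negSucc n) 0 = 0 := by omega
      simpa [h3] using h1
    · exact absurd rfl hm

theorem AWtLE.b_prod {w : ℤ} {v : Dch} (h : AWtLE w v) (l : List ℤ) (hl : 0 ∉ l) :
    AWtLE (w - (l.map fun n => max n 0).sum) ((l.map ChiralDiffOp.b).prod v) := by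
  induction l with
  | nil => simpa using h
  | cons n l ih =>
    simp only [List.mem_cons, not_or] at hl
    have := (ih hl.2).b n (Ne.symm hl.1)
    simp only [List.map_cons, List.prod_cons, List.sum_cons, Module.End.mul_apply]
    convert this using 1
    ring

theorem AWtLE.sum_le {w : ℤ} {v : Dch} (h : AWtLE w v) (l : List ℤ) (hl : 0 ∉ l)
    (hv : (l.map ChiralDiffOp.b).prod v ≠ 0) : (l.map fun n => max n 0).sum ≤ w := by
  by_contra hlt
  exact hv ((h.b_prod l hl).eq_zero (by omega))

theorem length_le_of_nonzero (l : List ℤ) (hl : 0 ∉ l) :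
    (l.length : ℤ) ≤ 2 * (l.map fun n => max n 0).sum - l.sum ∧
      ∀ n ∈ l, |n| ≤ 2 * (l.map fun n => max n 0).sum - l.sum := by
  induction l with
  | nil => simp
  | cons k l ih =>
    simp only [List.mem_cons, not_or] at hl
    obtain ⟨h1, h2⟩ := ih hl.2
    have hk : 2 * max k 0 - k = |k| := by
      rcases le_total k 0 with h | h
      · rw [max_eq_right h, abs_of_nonpos h]; ring
      · rw [max_eq_left h, abs_of_nonneg h]; ring
    have hk0 : 0 < |k| := abs_pos.mpr (Ne.symm hl.1)
    simp only [List.map_cons, List.sum_cons, List.length_cons, List.mem_cons]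
    refine ⟨by push_cast; omega, fun n hn => ?_⟩
    rcases hn with rfl | hn
    · omega
    · have := h2 n hn
      omega

theorem finite_lists (B : ℕ) :
    {l : List ℤ | l.length ≤ B ∧ ∀ n ∈ l, |n| ≤ (B : ℤ)}.Finite := by
  let S : Set ℤ := Set.Icc (-(B : ℤ)) B
  have hf : ({l : List S | l.length ≤ B}).Finite := List.finite_length_le S B
  refine (hf.image (List.map Subtype.val)).subset ?_
  rintro l ⟨h1, h2⟩
  have h3 : ∀ n ∈ l, n ∈ S := fun n hn => abs_le.mp (h2 n hn)
  refine ⟨l.attachWith (· ∈ S) h3, by simpa using h1, by simp⟩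

/-! ### Modes of the fields -/

/-- Finite sequences `(n_1, …, n_i)` (of arbitrary length `i ≥ 0`) of nonzero integers with sum
`m`. -/
abbrev NonzeroSeq (m : ℤ) : Type := {l : List ℤ // 0 ∉ l ∧ l.sum = m}

/-- The summand `(∂^i f / i!) b_{n_1} ⋯ b_{n_i}` of the field of `f(b)`. -/
def fnTerm (f : Hol) (l : List ℤ) : Module.End ℂ Dch :=
  ((l.length.factorial : ℂ)⁻¹) • (mulBy (C ((dTau ^ l.length) f)) * (l.map b).prod)

theorem fnTerm_support (f : Hol) (m : ℤ) (v : Dch) :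
    (Function.support fun l : NonzeroSeq m => fnTerm f l v).Finite := by
  obtain ⟨w, hw⟩ := AWtLE.exists v
  refine Set.Finite.of_finite_image (f := Subtype.val)
    ((finite_lists (2 * w - m).toNat).subset ?_) Subtype.val_injective.injOn
  rintro _ ⟨⟨l, hl, hs⟩, hv, rfl⟩
  have hv' : (l.map b).prod v ≠ 0 := by
    intro h0
    apply hv
    simp [fnTerm, h0]
  have h1 := hw.sum_le l hl hv'
  obtain ⟨h2, h3⟩ := length_le_of_nonzero l hl
  refine ⟨by zify; omega, fun n hn => ?_⟩
  have := h3 n hn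
  omega

/-- The mode `f(b)_m`, i.e. the coefficient of `z^{-m}` in the field
`Y(f, z) = Σ_i (∂^i f(b) / i!) (Σ_{n ≠ 0} b_n z^{-n})^i`. -/
def fnMode (f : Hol) (m : ℤ) : Module.End ℂ Dch :=
  locFinSum (fun l : NonzeroSeq m => fnTerm f l) (fnTerm_support f m)

theorem fnMode_eq_zero (f : Hol) (m : ℤ) {w : ℤ} {v : Dch} (h : AWtLE w v) (hm : w < m) :
    fnMode f m v = 0 := by
  refine (finsum_congr fun l : NonzeroSeq m => ?_).trans finsum_zero
  obtain ⟨l, hl, hs⟩ := l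
  by_contra hne
  have hv' : (l.map b).prod v ≠ 0 := by
    intro h0
    apply hne
    simp [fnTerm, h0]
  have h1 := h.sum_le l hl hv'
  have h2 : l.sum ≤ (l.map fun n => max n 0).sum := by
    have := List.sum_le_sum (l := l) (f := id) (g := fun n => max n 0)
      fun n _ => le_max_left n 0
    simpa using this
  omega

theorem aFnMode_support (f : Hol) (n : ℤ) (v : Dch) :
    (Function.support fun k : ℕ =>
      (a (-(k + 1 : ℤ)) * fnMode f (n + k + 1) + fnMode f (n - k) * a k) v).Finite := by
  obtain ⟨w, hw⟩ := AWtLE.exists v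
  have h1 : {k : ℕ | a (k : ℤ) v ≠ 0}.Finite := by
    have hfin : ((fun k : ℕ => (Sum.inr k.succPNat : Gen)) ⁻¹' (v.vars : Set Gen)).Finite :=
      v.vars.finite_toSet.preimage
        (Sum.inr_injective.comp Nat.succPNat_injective).injOn
    refine ((hfin.image Nat.succ).insert 0).subset fun k hk => ?_
    rcases k with _ | k
    · exact Set.mem_insert _ _
    · refine Set.mem_insert_of_mem _ ⟨k, ?_, rfl⟩
      by_contra hnot
      exact hk (pderiv_eq_zero_of_notMem_vars hnot)
  refine (h1.union (Set.finite_Iic (w - n).toNat)).subset fun k hk => ?_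
  by_contra hnot
  simp only [Set.mem_union, Set.mem_ofPred_eq, Set.mem_Iic, not_or, not_not, not_le] at hnot
  apply hk
  have h2 : fnMode f (n + k + 1) v = 0 := fnMode_eq_zero f _ hw (by omega)
  simp [h2, hnot.1]

/-- The mode of index `n` (coefficient of `z^{-n-1}`) of the field of `a_{-1} f(b)`, that is of the
normally ordered product of `a(z)` and `Y(f, z)`:
`Σ_{k ≥ 1} a_{-k} f(b)_{n+k} + Σ_{k ≥ 0} f(b)_{n-k} a_k`. -/
def aFnMode (f : Hol) (n : ℤ) : Module.End ℂ Dch :=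
  locFinSum (fun k : ℕ =>
    a (-(k + 1 : ℤ)) * fnMode f (n + k + 1) + fnMode f (n - k) * a k) (aFnMode_support f n)

/-! ### The right action of `SL(2, ℝ)` -/

/-- The function `τ ↦ gτ = (ατ + β) / (γτ + δ)`, which is `π(g) b`. -/
def mob (g : SL(2, ℝ)) : Hol := subst g tau

/-- The mode `(π(g)a)_n` of `π(g)a = a_{-1} (γ b + δ)² + 2 γ² b_{-1}`. The field of
`b_{-1} = T b` is `∂_z b(z)`, with modes `-n b_n`. -/
def piA (g : SL(2, ℝ)) (n : ℤ) : Module.End ℂ Dch :=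
  aFnMode (den g ^ 2) n + (2 * ((g 1 0 : ℝ) : ℂ) ^ 2 * (-n : ℂ)) • b n

/-- The mode `(π(g)b)_n` of `π(g)b = (α b + β) / (γ b + δ)`. -/
def piB (g : SL(2, ℝ)) (n : ℤ) : Module.End ℂ Dch := fnMode (mob g) n

/-- The partition `λ` of a monomial `a_{-λ} b_{-μ}`, as a weakly decreasing list. -/
def lam (m : Gen →₀ ℕ) : List ℕ+ :=
  (m.comapDomain Sum.inl Sum.inl_injective.injOn).toMultiset.sort (· ≥ ·)

/-- The partition `μ` of a monomial `a_{-λ} b_{-μ}`, as a weakly decreasing list. -/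
def mu (m : Gen →₀ ℕ) : List ℕ+ :=
  (m.comapDomain Sum.inr Sum.inr_injective.injOn).toMultiset.sort (· ≥ ·)

/-- The operator `π(g)`:
`π(g)(a_{-λ} b_{-μ} f(b)) =
  (π(g)a)_{-λ_1} ⋯ (π(g)a)_{-λ_d} (π(g)b)_{-μ_1} ⋯ (π(g)b)_{-μ_e} f(gb)`. -/
def piOp (g : SL(2, ℝ)) : Module.End ℂ Dch :=
  ofMonomials fun m =>
    (((lam m).map fun n => piA g (-(n : ℤ))).prod * ((mu m).map fun n => piB g (-(n : ℤ))).prod)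
      ∘ₗ (monomial 0).restrictScalars ℂ ∘ₗ subst g

/-- The operator `π(g)` for an integral matrix `g`. -/
def piZ (g : SL(2, ℤ)) : Module.End ℂ Dch :=
  piOp (Matrix.SpecialLinearGroup.map (Int.castRingHom ℝ) g)

/-! ### Conformal weights and the cuspidal condition -/

/-- The subspace of conformal weight `N`: the elements all of whose monomials
`a_{-λ} b_{-μ} f(b)` satisfy `|λ| + |μ| = N`. -/
def weightSpace (N : ℕ) : Submodule ℂ Dch :=
  (weightedHomogeneousSubmodule Hol
    (Sum.elim (fun n : ℕ+ => (n : ℕ)) fun n : ℕ+ => (n : ℕ)) N).restrictScalars ℂ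

/-- `f` has a Fourier expansion `f(τ) = Σ u(m) e^{2πi m τ / h}` for some integer `h > 0`, with
`u(m) = 0` for all `m < 0`. -/
def IsRegularAtInfty (f : Hol) : Prop :=
  ∃ h : ℕ, 0 < h ∧ ∃ u : ℕ → ℂ, ∀ z : ℍ,
    HasSum (fun m : ℕ => u m * Complex.exp (2 * Real.pi * Complex.I * m * z / h)) (f z)

theorem IsRegularAtInfty.zero : IsRegularAtInfty 0 :=
  ⟨1, one_pos, 0, fun z => by simp [Hol.zero_apply, hasSum_zero]⟩

theorem IsRegularAtInfty.smul (c : ℂ) {f : Hol} (hf : IsRegularAtInfty f) :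
    IsRegularAtInfty (c • f) := by
  obtain ⟨h, hh, u, hu⟩ := hf
  refine ⟨h, hh, fun m => c * u m, fun z => ?_⟩
  simpa [Hol.smul_apply, mul_assoc] using (hu z).mul_left c

theorem IsRegularAtInfty.rescale {f : Hol} {h : ℕ} (hh : 0 < h) {u : ℕ → ℂ}
    (hu : ∀ z : ℍ, HasSum
      (fun m : ℕ => u m * Complex.exp (2 * Real.pi * Complex.I * m * z / h)) (f z))
    {k : ℕ} (hk : 0 < k) :
    ∃ u' : ℕ → ℂ, ∀ z : ℍ, HasSum
      (fun m : ℕ => u' m * Complex.exp (2 * Real.pi * Complex.I * m * z / (h * k : ℕ)))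
      (f z) := by
  have hinj : Function.Injective fun m : ℕ => m * k := fun x y hxy =>
    Nat.eq_of_mul_eq_mul_right hk hxy
  refine ⟨Function.extend (fun m : ℕ => m * k) u 0, fun z => ?_⟩
  rw [← hinj.hasSum_iff]
  · convert hu z using 2 with m
    simp only [Function.comp_apply, hinj.extend_apply]
    congr 2
    have h1 : (h : ℂ) ≠ 0 := by exact_mod_cast hh.ne'
    have h2 : (k : ℂ) ≠ 0 := by exact_mod_cast hk.ne'
    push_cast
    field_simp
  · intro m hm
    rw [Function.extend_apply' _ _ _ (by simpa using hm)]
    simp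

theorem IsRegularAtInfty.add {f g : Hol} (hf : IsRegularAtInfty f) (hg : IsRegularAtInfty g) :
    IsRegularAtInfty (f + g) := by
  obtain ⟨h, hh, u, hu⟩ := hf
  obtain ⟨k, hk, v, hv⟩ := hg
  obtain ⟨u', hu'⟩ := rescale hh hu hk
  obtain ⟨v', hv'⟩ := rescale hk hv hh
  refine ⟨h * k, Nat.mul_pos hh hk, fun m => u' m + v' m, fun z => ?_⟩
  have h2 := hv' z
  rw [mul_comm k h] at h2
  simpa [Hol.add_apply, add_mul] using (hu' z).add h2

/-- `v = Σ a_{-λ} b_{-μ} f_{λ,μ}` is holomorphic at `∞` if all `f_{λ,μ}` are. -/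
def IsHolAtInfty (v : Dch) : Prop := ∀ m, IsRegularAtInfty (coeff m v)

/-- `v` is holomorphic at the cusp `c ∈ ℚ ∪ {∞}`: for `ρ ∈ SL(2, ℤ)` which carries `∞` to `c`, the
vector `π(ρ) v` is holomorphic at `∞`. -/
def IsHolAtCusp (c : OnePoint ℚ) (v : Dch) : Prop :=
  ∀ ρ : SL(2, ℤ), Matrix.SpecialLinearGroup.mapGL ℚ ρ • (OnePoint.infty : OnePoint ℚ) = c →
    IsHolAtInfty (piZ ρ v)

/-- `𝒟^ch(ℍ, Γ)`: the `Γ`-invariant vectors which are holomorphic at all cusps. -/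
def invariants (Γ : Subgroup SL(2, ℤ)) : Submodule ℂ Dch where
  carrier := {v | (∀ g ∈ Γ, piZ g v = v) ∧ ∀ c : OnePoint ℚ, IsHolAtCusp c v}
  zero_mem' := by
    refine ⟨fun g _ => map_zero _, fun c ρ _ m => ?_⟩
    rw [map_zero, coeff_zero]
    exact .zero
  add_mem' := by
    rintro v w ⟨hv, hv'⟩ ⟨hw, hw'⟩
    refine ⟨fun g hg => by rw [map_add, hv g hg, hw g hg], fun c ρ hρ m => ?_⟩
    rw [map_add, coeff_add]
    exact (hv' c ρ hρ m).add (hw' c ρ hρ m)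
  smul_mem' := by
    rintro x v ⟨hv, hv'⟩
    refine ⟨fun g hg => by rw [map_smul, hv g hg], fun c ρ hρ m => ?_⟩
    rw [map_smul, coeff_smul]
    exact (hv' c ρ hρ m).smul x

/-- `𝒟^ch(ℍ, Γ)_N`: the subspace of `𝒟^ch(ℍ, Γ)` of conformal weight `N`. -/
def invariantsOfWeight (Γ : Subgroup SL(2, ℤ)) (N : ℕ) : Submodule ℂ Dch :=
  invariants Γ ⊓ weightSpace N

end ChiralDiffOp

end

/-!
Give the monomial `a_{-λ} b_{-μ}` the charge `p(λ) - p(μ)`, the number of parts of `λ` minus the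
number of parts of `μ`, and filter `𝒟^ch(ℍ)` by the subspaces `chargeLE w` of elements all of whose
monomials have charge at most `w`. Each `b_n` with `n ≠ 0` lowers the charge by one, and each `a_n`
raises it by at most one. In the field of `f(b)` a product of `i` operators `b_n` therefore lowers
the charge by `i`, so only the terms with the fewest `b_n` matter for leading terms:
`(π(g)a)_{-n}` is `(γτ + δ)² a_{-n}` and `(π(g)b)_{-n}` is `(d(gτ)/dτ) b_{-n}`, both up to operators
of smaller charge. As `d(gτ)/dτ = (γτ + δ)^{-2}`, the operator `π(g)` preserves the filtration and
acts on the coefficient at a monomial of top charge `w` by `f(τ) ↦ (γτ + δ)^{2w} f(gτ)`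
(`piOp_sub_leadOp_mem_degLE`, `coeff_piOp_apply`).

Consequently the coefficients of top charge `w` of an invariant vector which is holomorphic at the
cusps are modular forms of weight `-2w` for `Γ` (`topCoeff`). A vector all of whose coefficients of
charge `w` vanish lies in the next smaller step of the filtration. In conformal weight `N` there are
only finitely many monomials, so the filtration has finitely many steps, each of them
finite-dimensional as soon as the spaces of modular forms are.

Modular forms of weight `k` for a group containing `Γ(N)` form a finite-dimensional space
(`finiteDimensional_modularForm`): if enough Fourier coefficients of `f` vanish, then so do enough
Fourier coefficients of its norm to `SL(2, ℤ)`, which is zero by the Sturm bound in level one.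
-/

noncomputable section

namespace ChiralDiffOp

open UpperHalfPlane MvPolynomial

/-! ### Modular forms for congruence subgroups -/

section ModularForms

open ModularForm CongruenceSubgroup Matrix.SpecialLinearGroup Function
open scoped Manifold Pointwise

/-- Since `Γ(N)` is normal in `SL(2, ℤ)`, all translates of a form for a group containing `Γ(N)`
have the common period `N`. -/
theorem natCast_mem_strictPeriods_translate {Γ : Subgroup SL(2, ℤ)} {N : ℕ}
    (hΓ : Gamma N ≤ Γ) {r : GL (Fin 2) ℝ} (hr : r ∈ 𝒮ℒ) :
    (N : ℝ) ∈ (ConjAct.toConjAct r⁻¹ • (Γ.map (mapGL ℝ))).strictPeriods := by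
  obtain ⟨γ, rfl⟩ := hr
  have h1 : (N : ℝ) ∈ ((Gamma N).map (mapGL ℝ)).strictPeriods := by
    rw [CongruenceSubgroup.strictPeriods_Gamma]
    exact AddSubgroup.mem_zmultiples _
  rw [Subgroup.mem_strictPeriods_iff] at h1 ⊢
  obtain ⟨t, ht, ht'⟩ := h1
  rw [← ht', Subgroup.mem_pointwise_smul_iff_inv_smul_mem, ConjAct.toConjAct_inv, inv_inv,
    ConjAct.toConjAct_smul, ← map_inv, ← map_mul, ← map_mul]
  exact Subgroup.mem_map_of_mem _ (hΓ ((Gamma_normal N).conj_mem _ ht γ))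

/-- Translates of a form under `SL(2, ℤ)` satisfy what is needed to have a `q`-expansion with
respect to the period `N`. -/
theorem translate_regular {Γ : Subgroup SL(2, ℤ)} {N : ℕ} (hN : 0 < N) (hΓ : Gamma N ≤ Γ) {k : ℤ}
    (f : ModularForm (Γ.map (mapGL ℝ)) k) {r : GL (Fin 2) ℝ} (hr : r ∈ 𝒮ℒ) :
    Periodic (((f : ℍ → ℂ) ∣[k] r) ∘ ofComplex) (N : ℝ) ∧
      MDifferentiable 𝓘(ℂ) 𝓘(ℂ) ((f : ℍ → ℂ) ∣[k] r) ∧ IsBoundedAtImInfty ((f : ℍ → ℂ) ∣[k] r) := by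
  have hp := natCast_mem_strictPeriods_translate hΓ hr
  have hN' : (0 : ℝ) < N := by exact_mod_cast hN
  have : Fact (IsCusp OnePoint.infty (ConjAct.toConjAct r⁻¹ • (Γ.map (mapGL ℝ)))) :=
    ⟨Subgroup.isCusp_of_mem_strictPeriods hN' hp⟩
  exact ⟨SlashInvariantFormClass.periodic_comp_ofComplex (translate f r) hp,
    (translate f r).holo', ModularFormClass.bdd_at_infty (translate f r)⟩

/-- The `q`-expansion with respect to the period `N` of a function with period `1` is obtained
from the one with respect to the period `1` by substituting `q ^ N` for `q`. -/
theorem coeff_qExpansion_one_eq {E : Type*} [FunLike E ℍ ℂ] {F : E} {N : ℕ} (hN : 0 < N)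
    (hper : Periodic (F ∘ ofComplex) (1 : ℝ)) (hhol : MDifferentiable 𝓘(ℂ) 𝓘(ℂ) F)
    (hbdd : IsBoundedAtImInfty F) (m : ℕ) :
    (qExpansion 1 F).coeff m = (qExpansion N F).coeff (m * N) := by
  have hN' : (0 : ℝ) < N := by exact_mod_cast hN
  have hperN : Periodic (F ∘ ofComplex) ((N : ℝ) : ℂ) := by
    simpa using hper.nat_mul N
  have hinj : Injective fun m : ℕ => m * N := fun x y hxy => Nat.eq_of_mul_eq_mul_right hN hxy
  have key := qExpansion_coeff_unique (h := (N : ℝ)) F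
    (c := extend (fun m : ℕ => m * N) (fun m => (qExpansion 1 F).coeff m) 0) hN'
    (analyticAt_cuspFunction_zero hN' hperN hhol hbdd) (fun τ => ?_) (m * N)
  · rw [← key]
    exact (hinj.extend_apply (fun m => (qExpansion 1 F).coeff m) 0 m).symm
  · rw [← hinj.hasSum_iff]
    · convert! hasSum_qExpansion one_pos hper hhol hbdd τ using 2 with m
      simp only [comp_apply, hinj.extend_apply]
      congr 1
      rw [mul_comm, pow_mul]
      congr 1
      simp only [Periodic.qParam, ← Complex.exp_nat_mul]
      congr 1
      have : (N : ℂ) ≠ 0 := by exact_mod_cast hN.ne'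
      push_cast
      field_simp
    · intro m hm
      rw [extend_apply' _ _ _ (by simpa using hm)]
      simp

/-- A bounded number of Fourier coefficients determines a form for a congruence subgroup: otherwise
its norm to `SL(2, ℤ)` would violate the Sturm bound for level one. -/
theorem exists_bound_qExpansion {Γ : Subgroup SL(2, ℤ)} {N : ℕ} (hN : 0 < N) (hΓ : Gamma N ≤ Γ)
    (k : ℤ) : ∃ M : ℕ, ∀ f : ModularForm (Γ.map (mapGL ℝ)) k,
      (∀ j < M, (qExpansion N f).coeff j = 0) → f = 0 := by
  have : Γ.FiniteIndex := IsCongruenceSubgroup.finiteIndex ⟨N, hN.ne', hΓ⟩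
  set 𝒢 : Subgroup (GL (Fin 2) ℝ) := Γ.map (mapGL ℝ) with h𝒢
  have : 𝒢.IsArithmetic := inferInstance
  set K : ℤ := k * Nat.card (𝒮ℒ ⧸ 𝒢.subgroupOf 𝒮ℒ)
  have hN' : (0 : ℝ) < N := by exact_mod_cast hN
  refine ⟨(K.toNat / 12 + 1) * N, fun f hf => ?_⟩
  suffices hn : ModularForm.norm 𝒮ℒ f = 0 by
    simpa using (ModularForm.norm_eq_zero_iff 𝒮ℒ (f := f)).mp hn
  refine sturm_bound_levelOne ?_
  have h1 : (1 : ℝ) ∈ Subgroup.strictPeriods 𝒮ℒ := by simp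
  refine lt_of_lt_of_le (b := ((K.toNat / 12 + 1 : ℕ) : ℕ∞)) (by exact_mod_cast Nat.lt_succ_self _)
    (PowerSeries.nat_le_order _ _ fun m hm => ?_)
  rw [coeff_qExpansion_one_eq hN
    (SlashInvariantFormClass.periodic_comp_ofComplex (ModularForm.norm 𝒮ℒ f) h1)
    (ModularForm.norm 𝒮ℒ f).holo' (ModularFormClass.bdd_at_infty _)]
  classical
  let := Fintype.ofFinite (𝒮ℒ ⧸ 𝒢.subgroupOf 𝒮ℒ)
  have hreg : ∀ q : 𝒮ℒ ⧸ 𝒢.subgroupOf 𝒮ℒ,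
      AnalyticAt ℂ (cuspFunction N (SlashInvariantForm.quotientFunc f q)) 0 :=
    Quotient.forall.mpr fun r => by
      obtain ⟨h1, h2, h3⟩ := translate_regular hN hΓ f (inv_mem r.2)
      exact analyticAt_cuspFunction_zero hN' h1 h2 h3
  -- The factor of the norm at the trivial coset is `f` itself.
  have hone : SlashInvariantForm.quotientFunc f (⟦1⟧ : 𝒮ℒ ⧸ 𝒢.subgroupOf 𝒮ℒ) = (f : ℍ → ℂ) := by
    rw [SlashInvariantForm.quotientFunc_mk]
    simp
  have hprod : ∀ s : Finset (𝒮ℒ ⧸ 𝒢.subgroupOf 𝒮ℒ),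
      AnalyticAt ℂ (cuspFunction N (∏ q ∈ s, SlashInvariantForm.quotientFunc f q)) 0 := by
    intro s
    induction s using Finset.induction_on with
    | empty =>
      rw [Finset.prod_empty]
      refine analyticAt_cuspFunction_zero hN' (fun _ => rfl) mdifferentiable_const ?_
      exact Filter.const_boundedAtFilter _ (1 : ℂ)
    | insert q s hq ih =>
      rw [Finset.prod_insert hq, cuspFunction_mul (hreg q).continuousAt ih.continuousAt]
      exact (hreg q).mul ih
  have hsplit : ((ModularForm.norm 𝒮ℒ f : ModularForm 𝒮ℒ _) : ℍ → ℂ) =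
      f * ∏ q ∈ Finset.univ.erase (⟦1⟧ : 𝒮ℒ ⧸ 𝒢.subgroupOf 𝒮ℒ),
        SlashInvariantForm.quotientFunc f q := by
    rw [← hone, Finset.mul_prod_erase _ _ (Finset.mem_univ _)]
    exact ModularForm.coe_norm ..
  have hf0 := hreg ⟦1⟧
  rw [hone] at hf0
  rw [hsplit]
  refine (congrArg _ (qExpansion_mul hf0 (hprod _))).trans ?_
  refine PowerSeries.coeff_of_lt_order _ (lt_of_lt_of_le ?_ (PowerSeries.le_order_mul ..))
  refine lt_of_lt_of_le ?_ le_self_add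
  refine lt_of_lt_of_le (b := (((K.toNat / 12 + 1) * N : ℕ) : ℕ∞)) ?_
    (PowerSeries.nat_le_order _ _ hf)
  exact_mod_cast Nat.mul_lt_mul_of_pos_right hm hN

/-- The space of modular forms of given weight for a congruence subgroup is finite-dimensional. -/
theorem finiteDimensional_modularForm {Γ : Subgroup SL(2, ℤ)} (hΓ : IsCongruenceSubgroup Γ)
    (k : ℤ) : FiniteDimensional ℂ (ModularForm (Γ.map (mapGL ℝ)) k) := by
  obtain ⟨N, hN0, hΓN⟩ := hΓ
  have hN : 0 < N := Nat.pos_of_ne_zero hN0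
  have hN' : (0 : ℝ) < N := by exact_mod_cast hN
  obtain ⟨M, hM⟩ := exists_bound_qExpansion hN hΓN k
  have hper : (N : ℝ) ∈ (Γ.map (mapGL ℝ)).strictPeriods := by
    simpa using natCast_mem_strictPeriods_translate hΓN (one_mem 𝒮ℒ)
  let φ : ModularForm (Γ.map (mapGL ℝ)) k →ₗ[ℂ] (Fin M → ℂ) :=
    { toFun f j := (qExpansion N f).coeff j
      map_add' f g := by
        ext j
        simp [ModularForm.qExpansion_add hN' hper f g]
      map_smul' c f := by
        ext j
        simp [ModularForm.qExpansion_smul hN' hper c f] }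
  refine Module.Finite.of_injective φ ((injective_iff_map_eq_zero φ).mpr fun f hf => ?_)
  exact hM f fun j hj => congr_fun hf ⟨j, hj⟩

end ModularForms

/-! ### The filtration by charge -/

/-- The charge of a monomial `a_{-λ} b_{-μ}`: the number of parts of `λ` minus the number of parts
of `μ`. -/
def charge : (Gen →₀ ℕ) →+ ℤ :=
  Finsupp.weight (Sum.elim (fun _ => 1) fun _ => -1)

theorem charge_single (i : Gen) :
    charge (Finsupp.single i 1) = Sum.elim (fun _ => (1 : ℤ)) (fun _ => -1) i := by
  simp [charge, Finsupp.weight_single]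

/-- The elements of `Dch` all of whose monomials have charge at most `w`. -/
def chargeLE (w : ℤ) : Submodule ℂ Dch where
  carrier := {v | ∀ m, coeff m v ≠ 0 → charge m ≤ w}
  zero_mem' m hm := absurd (coeff_zero m) hm
  add_mem' {u v} hu hv m hm := by
    by_contra hlt
    have h1 : coeff m u = 0 := by_contra fun h => hlt (hu m h)
    have h2 : coeff m v = 0 := by_contra fun h => hlt (hv m h)
    exact hm (by rw [coeff_add, h1, h2, add_zero])
  smul_mem' c v hv m hm := hv m fun h => hm (by rw [coeff_smul, h, smul_zero])

theorem chargeLE_mono {w w' : ℤ} (h : w ≤ w') : chargeLE w ≤ chargeLE w' :=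
  fun _ hv m hm => (hv m hm).trans h

theorem monomial_mem_chargeLE (m : Gen →₀ ℕ) (f : Hol) : monomial m f ∈ chargeLE (charge m) := by
  classical
  intro m' hm'
  rw [coeff_monomial] at hm'
  split_ifs at hm' with h
  · rw [h]
  · exact absurd rfl hm'

theorem C_mem_chargeLE (f : Hol) : (C f : Dch) ∈ chargeLE 0 := by
  simpa using monomial_mem_chargeLE 0 f

theorem X_mem_chargeLE (i : Gen) :
    (X i : Dch) ∈ chargeLE (Sum.elim (fun _ => (1 : ℤ)) (fun _ => -1) i) := by
  rw [← charge_single]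
  exact monomial_mem_chargeLE _ 1

theorem mul_mem_chargeLE {u v : Dch} {w w' : ℤ} (hu : u ∈ chargeLE w) (hv : v ∈ chargeLE w') :
    u * v ∈ chargeLE (w + w') := by
  classical
  intro m hm
  rw [coeff_mul] at hm
  obtain ⟨⟨i, j⟩, hij, hne⟩ := Finset.exists_ne_zero_of_sum_ne_zero hm
  rw [Finset.HasAntidiagonal.mem_antidiagonal] at hij
  rw [← hij, map_add]
  exact add_le_add (hu i (left_ne_zero_of_mul hne)) (hv j (right_ne_zero_of_mul hne))

theorem pderiv_mem_chargeLE {v : Dch} {w : ℤ} (hv : v ∈ chargeLE w) (i : Gen) :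
    pderiv i v ∈ chargeLE (w - Sum.elim (fun _ => (1 : ℤ)) (fun _ => -1) i) := by
  intro m hm
  have h := hv (m + Finsupp.single i 1) fun h0 => hm (by rw [coeff_pderiv, h0, zero_mul])
  rw [map_add, charge_single] at h
  linarith

/-- The operators which raise the charge by at most `d`. -/
def degLE (d : ℤ) : Submodule ℂ (Module.End ℂ Dch) where
  carrier := {T | ∀ w, ∀ v ∈ chargeLE w, T v ∈ chargeLE (w + d)}
  zero_mem' _ _ _ := zero_mem _
  add_mem' hS hT w v hv := add_mem (hS w v hv) (hT w v hv)
  smul_mem' c _ hT w v hv := Submodule.smul_mem _ c (hT w v hv)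

theorem degLE_mono {d d' : ℤ} (h : d ≤ d') : degLE d ≤ degLE d' :=
  fun _ hT w v hv => chargeLE_mono (by omega) (hT w v hv)

theorem mul_mem_degLE {S T : Module.End ℂ Dch} {d e : ℤ} (hS : S ∈ degLE d) (hT : T ∈ degLE e) :
    S * T ∈ degLE (d + e) := by
  intro w v hv
  have := hS _ _ (hT w v hv)
  rwa [add_assoc, add_comm e d] at this

theorem one_mem_degLE : (1 : Module.End ℂ Dch) ∈ degLE 0 := fun w v hv => by simpa using hv

theorem mulBy_mem_degLE {p : Dch} {d : ℤ} (hp : p ∈ chargeLE d) : mulBy p ∈ degLE d := by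
  intro w v hv
  rw [add_comm]
  exact mul_mem_chargeLE hp hv

theorem mulBy_mul (p q : Dch) : mulBy (p * q) = mulBy p * mulBy q :=
  LinearMap.ext fun v => mul_assoc p q v

theorem mulBy_one : mulBy 1 = 1 :=
  LinearMap.ext fun v => one_mul v

theorem ofMonomials_apply (φ : (Gen →₀ ℕ) → Hol →ₗ[ℂ] Dch) (v : Dch) :
    ofMonomials φ v = ∑ m ∈ v.support, φ m (coeff m v) := by
  conv_lhs => rw [← support_sum_monomial_coeff v, map_sum]
  exact Finset.sum_congr rfl fun m _ => ofMonomials_monomial φ m _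

theorem ofMonomials_sub (φ ψ : (Gen →₀ ℕ) → Hol →ₗ[ℂ] Dch) :
    ofMonomials φ - ofMonomials ψ = ofMonomials fun m => φ m - ψ m := by
  refine LinearMap.ext fun v => ?_
  simp only [LinearMap.sub_apply, ofMonomials_apply, Finset.sum_sub_distrib]

theorem ofMonomials_mem_degLE {φ : (Gen →₀ ℕ) → Hol →ₗ[ℂ] Dch} {d : ℤ}
    (h : ∀ m f, φ m f ∈ chargeLE (charge m + d)) : ofMonomials φ ∈ degLE d := by
  intro w v hv
  rw [ofMonomials_apply]
  refine sum_mem fun m hm => chargeLE_mono ?_ (h m _)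
  have := hv m (mem_support_iff.mp hm)
  omega

theorem b_mem_degLE {n : ℤ} (hn : n ≠ 0) : b n ∈ degLE (-1) := by
  match n, hn with
  | .ofNat (n + 1), _ =>
    exact neg_mem fun w v hv => by simpa using! pderiv_mem_chargeLE hv (Sum.inl n.succPNat)
  | .negSucc n, _ => exact mulBy_mem_degLE (X_mem_chargeLE (Sum.inr n.succPNat))

theorem a_mem_degLE (n : ℤ) : a n ∈ degLE 1 := by
  match n with
  | .ofNat 0 =>
    refine degLE_mono zero_le_one (ofMonomials_mem_degLE fun m f => ?_)
    rw [add_zero]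
    exact monomial_mem_chargeLE m (dTau f)
  | .ofNat (n + 1) =>
    exact fun w v hv => by simpa using! pderiv_mem_chargeLE hv (Sum.inr n.succPNat)
  | .negSucc n => exact mulBy_mem_degLE (X_mem_chargeLE (Sum.inl n.succPNat))

theorem prod_b_mem_degLE {l : List ℤ} (hl : 0 ∉ l) : (l.map b).prod ∈ degLE (-l.length) := by
  induction l with
  | nil => simpa using one_mem_degLE
  | cons n l ih =>
    simp only [List.mem_cons, not_or] at hl
    rw [List.map_cons, List.prod_cons, List.length_cons]
    refine degLE_mono ?_ (mul_mem_degLE (b_mem_degLE (Ne.symm hl.1)) (ih hl.2))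
    push_cast
    omega

theorem fnTerm_mem_degLE (f : Hol) {l : List ℤ} (hl : 0 ∉ l) : fnTerm f l ∈ degLE (-l.length) := by
  refine Submodule.smul_mem _ _ ?_
  simpa using mul_mem_degLE (mulBy_mem_degLE (C_mem_chargeLE _)) (prod_b_mem_degLE hl)

/-! ### Leading terms of the transformed modes -/

theorem locFinSum_mem_degLE {ι : Type} {T : ι → Module.End ℂ Dch}
    (hT : ∀ v, (Function.support fun i => T i v).Finite) {d : ℤ} (h : ∀ i, T i ∈ degLE d) :
    locFinSum T hT ∈ degLE d := by
  intro w v hv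
  change ∑ᶠ i, T i v ∈ _
  rw [finsum_eq_sum _ (hT v)]
  exact sum_mem fun i _ => h i w v hv

/-- If all but one of the summands lie in `degLE d`, then the sum is congruent to the remaining
summand. -/
theorem locFinSum_sub_mem_degLE {ι : Type} {T : ι → Module.End ℂ Dch}
    (hT : ∀ v, (Function.support fun i => T i v).Finite) {d : ℤ} (i₀ : ι)
    (h : ∀ i, i ≠ i₀ → T i ∈ degLE d) : locFinSum T hT - T i₀ ∈ degLE d := by
  classical
  intro w v hv
  change ∑ᶠ i, T i v - T i₀ v ∈ _
  rw [finsum_eq_sum_of_support_subset (s := insert i₀ (hT v).toFinset) _ (by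
    intro i hi
    simpa using Or.inr hi), ← Finset.add_sum_erase _ _ (Finset.mem_insert_self _ _),
    add_sub_cancel_left]
  exact sum_mem fun i hi => h i (Finset.ne_of_mem_erase hi) w v hv

/-- A mode of nonzero index involves at least one `b_n`. -/
theorem fnMode_mem_degLE (f : Hol) {m : ℤ} (hm : m ≠ 0) : fnMode f m ∈ degLE (-1) := by
  refine locFinSum_mem_degLE _ fun ⟨l, hl, hs⟩ => degLE_mono ?_ (fnTerm_mem_degLE f hl)
  have : l ≠ [] := by
    rintro rfl
    exact hm (by simpa using hs.symm)
  have := List.length_pos_iff.mpr this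
  change -(l.length : ℤ) ≤ -1
  omega

theorem fnMode_zero_sub_mem_degLE (f : Hol) : fnMode f 0 - mulBy (C f) ∈ degLE (-1) := by
  have h0 : fnTerm f [] = mulBy (C f) := by simp [fnTerm]
  rw [← h0]
  refine locFinSum_sub_mem_degLE (T := fun l : NonzeroSeq 0 => fnTerm f l) _
    ⟨[], by simp, by simp⟩ fun ⟨l, hl, hs⟩ hne => degLE_mono ?_ (fnTerm_mem_degLE f hl)
  have : l ≠ [] := fun h => hne (Subtype.ext h)
  have := List.length_pos_iff.mpr this
  change -(l.length : ℤ) ≤ -1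
  omega

theorem b_neg (n : ℕ+) : b (-(n : ℤ)) = mulBy (X (Sum.inr n)) := by
  obtain ⟨k, rfl⟩ : ∃ k : ℕ, n = k.succPNat := ⟨n.natPred, (PNat.succPNat_natPred n).symm⟩
  rfl

theorem a_neg (n : ℕ+) : a (-(n : ℤ)) = mulBy (X (Sum.inl n)) := by
  obtain ⟨k, rfl⟩ : ∃ k : ℕ, n = k.succPNat := ⟨n.natPred, (PNat.succPNat_natPred n).symm⟩
  rfl

/-- The only term of `f(b)_{-n}` with fewer than two operators `b_j` is `f'(b) b_{-n}`. -/
theorem fnMode_sub_mem_degLE (f : Hol) (n : ℕ+) :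
    fnMode f (-(n : ℤ)) - mulBy (C (dTau f) * X (Sum.inr n)) ∈ degLE (-2) := by
  have h0 : fnTerm f [-(n : ℤ)] = mulBy (C (dTau f) * X (Sum.inr n)) := by
    simp [fnTerm, b_neg, mulBy_mul]
  rw [← h0]
  refine locFinSum_sub_mem_degLE (T := fun l : NonzeroSeq (-(n : ℤ)) => fnTerm f l) _
    ⟨[-(n : ℤ)], by simp, by simp⟩ fun ⟨l, hl, hs⟩ hne => degLE_mono ?_ (fnTerm_mem_degLE f hl)
  rcases l with _ | ⟨k, _ | ⟨k', l⟩⟩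
  · simp at hs
  · exact absurd (Subtype.ext (by simpa using hs)) hne
  · change -((l.length + 1 + 1 : ℕ) : ℤ) ≤ -2
    push_cast
    omega

/-- Only the term `a_{-n} f(b)_0` of the normally ordered product contains the leading term
`f(b) a_{-n}`: in the others an `a_j` is multiplied by a mode `f(b)_m` with `m ≠ 0`. -/
theorem aFnMode_sub_mem_degLE (f : Hol) (n : ℕ+) :
    aFnMode f (-(n : ℤ)) - mulBy (C f * X (Sum.inl n)) ∈ degLE 0 := by
  have hn := n.pos
  have hlead : ∀ S T : Module.End ℂ Dch, S ∈ degLE 1 → T ∈ degLE (-1) → S * T ∈ degLE 0 :=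
    fun S T hS hT => by simpa using mul_mem_degLE hS hT
  have hsnd : ∀ k : ℕ, fnMode f (-(n : ℤ) - k) * a k ∈ degLE 0 := fun k => by
    simpa using mul_mem_degLE (fnMode_mem_degLE f (m := -(n : ℤ) - k) (by omega)) (a_mem_degLE k)
  have hpred : (n.natPred : ℤ) + 1 = n := by exact_mod_cast n.natPred_add_one
  have h1 := locFinSum_sub_mem_degLE (aFnMode_support f (-(n : ℤ))) (d := 0) n.natPred
    fun k hk => add_mem (hlead _ _ (a_mem_degLE _) (fnMode_mem_degLE f (by omega))) (hsnd k)
  have h2 : a (-(n : ℤ)) * (fnMode f 0 - mulBy (C f)) +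
      fnMode f (-(n : ℤ) - n.natPred) * a n.natPred ∈ degLE 0 :=
    add_mem (hlead _ _ (a_mem_degLE _) (fnMode_zero_sub_mem_degLE f)) (hsnd n.natPred)
  have h3 := add_mem h1 h2
  rw [hpred, add_assoc (-(n : ℤ)), hpred, neg_add_cancel, mul_sub] at h3
  convert h3 using 1
  rw [a_neg, mul_comm (C f), mulBy_mul, aFnMode]
  abel

theorem piA_sub_mem_degLE (g : SL(2, ℝ)) (n : ℕ+) :
    piA g (-(n : ℤ)) - mulBy (C (den g ^ 2) * X (Sum.inl n)) ∈ degLE 0 := by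
  have hn := n.pos
  have h := add_mem (aFnMode_sub_mem_degLE (den g ^ 2) n)
    (Submodule.smul_mem (degLE 0) (2 * ((g 1 0 : ℝ) : ℂ) ^ 2 * (-(-(n : ℤ) : ℤ) : ℂ))
      (degLE_mono (by norm_num) (b_mem_degLE (n := -(n : ℤ)) (by omega))))
  convert h using 1
  simp only [piA]
  abel

theorem piB_sub_mem_degLE (g : SL(2, ℝ)) (n : ℕ+) :
    piB g (-(n : ℤ)) - mulBy (C (dTau (mob g)) * X (Sum.inr n)) ∈ degLE (-2) :=
  fnMode_sub_mem_degLE (mob g) n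

/-- If each factor `T i` equals multiplication by an element `p i` of charge at most `d` up to
terms of smaller charge, the same holds for products. -/
theorem prod_sub_mem_degLE {ι : Type} (T : ι → Module.End ℂ Dch) (p : ι → Dch) {d : ℤ}
    (hp : ∀ i, p i ∈ chargeLE d) (hT : ∀ i, T i - mulBy (p i) ∈ degLE (d - 1)) (l : List ι) :
    (l.map p).prod ∈ chargeLE (l.length * d) ∧
      (l.map T).prod - mulBy (l.map p).prod ∈ degLE (l.length * d - 1) := by
  induction l with
  | nil =>
    simp only [List.map_nil, List.prod_nil, mulBy_one, sub_self]
    exact ⟨by simpa using C_mem_chargeLE 1, zero_mem _⟩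
  | cons i l ih =>
    obtain ⟨ih1, ih2⟩ := ih
    simp only [List.map_cons, List.prod_cons, List.length_cons]
    have e : ((l.length + 1 : ℕ) : ℤ) * d = d + l.length * d := by push_cast; ring
    refine ⟨e ▸ mul_mem_chargeLE (hp i) ih1, ?_⟩
    have hprod : (l.map T).prod ∈ degLE (l.length * d) := by
      have := add_mem (degLE_mono (by omega) ih2) (mulBy_mem_degLE ih1)
      rwa [sub_add_cancel] at this
    have hsplit : T i * (l.map T).prod - mulBy (p i * (l.map p).prod) =
        (T i - mulBy (p i)) * (l.map T).prod +
          mulBy (p i) * ((l.map T).prod - mulBy (l.map p).prod) := by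
      rw [mulBy_mul, sub_mul, mul_sub]
      abel
    rw [hsplit, e]
    refine add_mem (degLE_mono ?_ (mul_mem_degLE (hT i) hprod))
      (degLE_mono ?_ (mul_mem_degLE (mulBy_mem_degLE (hp i)) ih2)) <;> omega

/-! ### The leading term of the group action -/

/-- A product over the parts of `λ` and `μ` is a product over all generators. -/
@[to_additive]
theorem prod_lam_mul_prod_mu {M : Type*} [CommMonoid M] (F : Gen → M) (m : Gen →₀ ℕ) :
    ((lam m).map fun n => F (Sum.inl n)).prod * ((mu m).map fun n => F (Sum.inr n)).prod =
      m.prod fun i e => F i ^ e := by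
  have key : ∀ (c : ℕ+ →₀ ℕ) (G : ℕ+ → M),
      ((c.toMultiset.sort (· ≥ ·)).map G).prod = c.prod fun n e => G n ^ e := by
    intro c G
    rw [← Multiset.prod_coe, ← Multiset.map_coe, Multiset.sort_eq, Finsupp.toMultiset_map,
      Finsupp.prod_toMultiset,
      Finsupp.prod_mapDomain_index (fun _ => pow_zero _) fun _ _ _ => pow_add _ _ _]
  conv_rhs => rw [← Finsupp.comapDomain_sumElim_comapDomain m, Finsupp.prod_sumElim]
  rw [lam, mu, key, key]
  rfl

theorem charge_eq (m : Gen →₀ ℕ) : charge m = (lam m).length - (mu m).length := by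
  have h := sum_lam_add_sum_mu (Sum.elim (fun _ => (1 : ℤ)) fun _ => -1) m
  simp only [Sum.elim_inl, Sum.elim_inr, List.map_const', List.sum_replicate] at h
  rw [charge, Finsupp.weight_apply, ← h]
  simp
  ring

/-- The automorphy factor by which the coefficient at the monomial `m` is multiplied in the leading
term of `π(g)`: `(γ τ + δ)²` for each part of `λ` and `d(gτ)/dτ` for each part of `μ`. -/
def autFactor (g : SL(2, ℝ)) (m : Gen →₀ ℕ) : Hol :=
  m.prod fun i e => Sum.elim (fun _ => den g ^ 2) (fun _ => dTau (mob g)) i ^ e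

/-- `d(gτ)/dτ = (γ τ + δ)^{-2}`. -/
theorem dTau_mob_apply (g : SL(2, ℝ)) (z : ℍ) :
    dTau (mob g) z = denom (g : GL (Fin 2) ℝ) z ^ (-2 : ℤ) := by
  have h := UpperHalfPlane.deriv_smul (g := (g : GL (Fin 2) ℝ)) (by simp) z
  refine h.trans ?_
  simp [zpow_neg]

theorem autFactor_apply (g : SL(2, ℝ)) (m : Gen →₀ ℕ) (z : ℍ) :
    autFactor g m z = denom (g : GL (Fin 2) ℝ) z ^ (2 * charge m) := by
  have hd : denom (g : GL (Fin 2) ℝ) z ≠ 0 := denom_ne_zero _ z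
  induction m using Finsupp.induction_linear with
  | zero =>
    have h : autFactor g 0 = 1 := Finsupp.prod_zero_index
    rw [h, map_zero, mul_zero, zpow_zero]
    rfl
  | add m m' h h' =>
    have hadd : autFactor g (m + m') = autFactor g m * autFactor g m' :=
      Finsupp.prod_add_index' (fun _ => pow_zero _) fun _ _ _ => pow_add _ _ _
    rw [hadd, Hol.mul_apply, map_add, mul_add, zpow_add₀ hd, ← h, ← h']
  | single i e =>
    have hpow : ∀ (f : Hol) (e : ℕ), (f ^ e) z = f z ^ e := fun f e => rfl
    have hden : den g z = denom (g : GL (Fin 2) ℝ) z := rfl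
    have hc : charge (Finsupp.single i e) = e * Sum.elim (fun _ => (1 : ℤ)) (fun _ => -1) i := by
      simp [charge, Finsupp.weight_apply]
    have hsingle : autFactor g (Finsupp.single i e) =
        Sum.elim (fun _ => den g ^ 2) (fun _ => dTau (mob g)) i ^ e :=
      Finsupp.prod_single_index (pow_zero _)
    rw [hsingle, hpow, hc]
    rcases i with n | n
    · simp only [Sum.elim_inl, hpow, hden]
      rw [← pow_mul, ← zpow_natCast]
      congr 1
      push_cast
      ring
    · simp only [Sum.elim_inr, dTau_mob_apply]
      rw [← zpow_natCast, ← zpow_mul]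
      congr 1
      ring

/-- The leading term of `π(g)` with respect to the filtration by charge. -/
def leadOp (g : SL(2, ℝ)) : Module.End ℂ Dch :=
  ofMonomials fun m =>
    (monomial m).restrictScalars ℂ ∘ₗ LinearMap.mulLeft ℂ (autFactor g m) ∘ₗ subst g

theorem coeff_leadOp (g : SL(2, ℝ)) (v : Dch) (m : Gen →₀ ℕ) :
    coeff m (leadOp g v) = autFactor g m * subst g (coeff m v) := by
  classical
  rw [leadOp, ofMonomials_apply, coeff_sum]
  have h : ∀ m' ∈ v.support, coeff m (((monomial m').restrictScalars ℂ ∘ₗ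
      LinearMap.mulLeft ℂ (autFactor g m') ∘ₗ subst g) (coeff m' v)) =
      if m' = m then autFactor g m' * subst g (coeff m' v) else 0 := fun m' _ =>
    coeff_monomial m m' (autFactor g m' * subst g (coeff m' v))
  rw [Finset.sum_congr rfl h, Finset.sum_ite_eq']
  split_ifs with hm
  · rfl
  · rw [notMem_support_iff.mp hm, map_zero, mul_zero]

/-- Up to terms of smaller charge, `π(g)` acts through the automorphy factors alone. -/
theorem piOp_sub_leadOp_mem_degLE (g : SL(2, ℝ)) : piOp g - leadOp g ∈ degLE (-1) := by
  rw [piOp, leadOp, ofMonomials_sub]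
  -- The coercion of the parts from `ℕ+` to `ℤ` in `piOp` is a `map` over the list monad.
  simp only [bind_pure_comp, List.map_eq_map, List.map_map]
  refine ofMonomials_mem_degLE fun m f => ?_
  have hX : ∀ (f : Hol) (i : Gen),
      (C f * X i : Dch) ∈ chargeLE (Sum.elim (fun _ => (1 : ℤ)) (fun _ => -1) i) := fun f i => by
    have h := mul_mem_chargeLE (C_mem_chargeLE f) (X_mem_chargeLE i)
    rwa [zero_add] at h
  have hTA : ∀ n : ℕ+, piA g (-(n : ℤ)) - mulBy (C (den g ^ 2) * X (Sum.inl n)) ∈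
      degLE (1 - 1) := fun n => by
    rw [sub_self]
    exact piA_sub_mem_degLE g n
  have hTB : ∀ n : ℕ+, piB g (-(n : ℤ)) - mulBy (C (dTau (mob g)) * X (Sum.inr n)) ∈
      degLE (-1 - 1) := fun n => by
    rw [show (-1 - 1 : ℤ) = -2 by norm_num]
    exact piB_sub_mem_degLE g n
  obtain ⟨hA, hA'⟩ := prod_sub_mem_degLE (fun n : ℕ+ => piA g (-(n : ℤ)))
    (fun n => C (den g ^ 2) * X (Sum.inl n)) (d := 1) (fun n => hX _ (Sum.inl n)) hTA (lam m)
  obtain ⟨hB, hB'⟩ := prod_sub_mem_degLE (fun n : ℕ+ => piB g (-(n : ℤ)))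
    (fun n => C (dTau (mob g)) * X (Sum.inr n)) (d := -1) (fun n => hX _ (Sum.inr n)) hTB (mu m)
  have hprod : ((lam m).map fun n => C (den g ^ 2) * X (Sum.inl n)).prod *
      ((mu m).map fun n => C (dTau (mob g)) * X (Sum.inr n)).prod =
      (monomial m (autFactor g m) : Dch) := by
    have h := prod_lam_mul_prod_mu
      (fun i => (C (Sum.elim (fun _ => den g ^ 2) (fun _ => dTau (mob g)) i) * X i : Dch)) m
    simp only [Sum.elim_inl, Sum.elim_inr] at h
    rw [h, monomial_eq, autFactor, Finsupp.prod, Finsupp.prod, Finsupp.prod, map_prod,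
      ← Finset.prod_mul_distrib]
    simp only [mul_pow, map_pow]
  set A := ((lam m).map fun n : ℕ+ => piA g (-(n : ℤ))).prod
  set B := ((mu m).map fun n : ℕ+ => piB g (-(n : ℤ))).prod
  set p := ((lam m).map fun n => (C (den g ^ 2) * X (Sum.inl n) : Dch)).prod
  set q := ((mu m).map fun n => (C (dTau (mob g)) * X (Sum.inr n) : Dch)).prod
  have hAB : A * B - mulBy (p * q) ∈ degLE (charge m - 1) := by
    have hBdeg : B ∈ degLE ((mu m).length * -1) := by
      have := add_mem (degLE_mono (by omega) hB') (mulBy_mem_degLE hB)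
      rwa [sub_add_cancel] at this
    have hsplit : A * B - mulBy (p * q) = (A - mulBy p) * B + mulBy p * (B - mulBy q) := by
      rw [mulBy_mul, sub_mul, mul_sub]
      abel
    rw [hsplit, charge_eq]
    exact add_mem (degLE_mono (by omega) (mul_mem_degLE hA' hBdeg))
      (degLE_mono (by omega) (mul_mem_degLE (mulBy_mem_degLE hA) hB'))
  have h := hAB 0 (monomial 0 (subst g f)) (by simpa using C_mem_chargeLE (subst g f))
  rw [hprod] at h
  have hmul : mulBy (monomial m (autFactor g m)) (monomial 0 (subst g f)) =
      monomial m (autFactor g m * subst g f) := by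
    change monomial m (autFactor g m) * monomial 0 (subst g f) = _
    rw [monomial_mul, add_zero]
  rw [LinearMap.sub_apply, hmul, zero_add] at h
  exact h

/-- The coefficients of `π(g) v` at the monomials of top charge are those of `v`, transformed like
modular forms. -/
theorem coeff_piOp_apply {v : Dch} {w : ℤ} (hv : v ∈ chargeLE w) (g : SL(2, ℝ)) {m : Gen →₀ ℕ}
    (hm : charge m = w) (z : ℍ) :
    coeff m (piOp g v) z =
      coeff m v ((g : GL (Fin 2) ℝ) • z) * denom (g : GL (Fin 2) ℝ) z ^ (2 * w) := by
  have h : coeff m (piOp g v - leadOp g v) = 0 := by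
    by_contra hne
    have := piOp_sub_leadOp_mem_degLE g w v hv m hne
    omega
  rw [coeff_sub, sub_eq_zero, coeff_leadOp] at h
  rw [h, Hol.mul_apply, autFactor_apply, hm, mul_comm]
  rfl

/-! ### Top coefficients are modular forms -/

section TopCoefficients

open Matrix.SpecialLinearGroup
open scoped Manifold ModularForm

theorem IsRegularAtInfty.isBoundedAtImInfty {f : Hol} (hf : IsRegularAtInfty f) :
    IsBoundedAtImInfty (f : ℍ → ℂ) := by
  obtain ⟨h, hh, u, hu⟩ := hf
  refine isBoundedAtImInfty_of_hasSum_qExpansion (h := h) (c := u) (by exact_mod_cast hh)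
    fun τ => ?_
  convert hu τ using 2 with m
  rw [smul_eq_mul, Function.Periodic.qParam, ← Complex.exp_nat_mul]
  congr 2
  push_cast
  ring

theorem coeff_piZ {v : Dch} {w : ℤ} (hv : v ∈ chargeLE w) (γ : SL(2, ℤ)) {m : Gen →₀ ℕ}
    (hm : charge m = w) :
    ((coeff m (piZ γ v) : Hol) : ℍ → ℂ) = ((coeff m v : Hol) : ℍ → ℂ) ∣[-2 * w] γ := by
  ext z
  rw [ModularForm.SL_slash_apply]
  refine (coeff_piOp_apply hv _ hm z).trans ?_
  rw [neg_mul, neg_neg]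
  rfl

/-- The coefficient of an invariant vector at a monomial of top charge `w` is a modular form of
weight `-2w`. -/
def topCoeff (Γ : Subgroup SL(2, ℤ)) [Γ.FiniteIndex] (w : ℤ) (m : Gen →₀ ℕ) (hm : charge m = w) :
    ↥(invariants Γ ⊓ chargeLE w) →ₗ[ℂ] ModularForm (Γ.map (mapGL ℝ)) (-2 * w) where
  toFun v :=
    { toFun := ((coeff m v.1 : Hol) : ℍ → ℂ)
      slash_action_eq' := by
        rintro _ ⟨γ, hγ, rfl⟩
        have h := coeff_piZ v.2.2 γ hm
        rw [v.2.1.1 γ hγ] at h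
        exact h.symm
      holo' := (coeff m v.1).mdifferentiable
      bdd_at_cusps' := by
        intro c hc
        rw [Subgroup.IsArithmetic.isCusp_iff_isCusp_SL2Z] at hc
        rw [OnePoint.isBoundedAt_iff_forall_SL2Z hc]
        intro γ _
        have h := (v.2.1.2 _ γ rfl m).isBoundedAtImInfty
        rwa [coeff_piZ v.2.2 γ hm] at h }
  map_add' _ _ := rfl
  map_smul' _ _ := rfl

end TopCoefficients

/-! ### Finite-dimensionality -/

/-- The conformal weight of a monomial. -/
abbrev conformalWeight : (Gen →₀ ℕ) →+ ℕ :=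
  Finsupp.weight (Sum.elim (fun n : ℕ+ => (n : ℕ)) fun n : ℕ+ => (n : ℕ))

theorem finite_conformalWeight_eq (N : ℕ) : {m : Gen →₀ ℕ | conformalWeight m = N}.Finite := by
  classical
  have hw : ∀ i : Gen, Sum.elim (fun n : ℕ+ => (n : ℕ)) (fun n : ℕ+ => (n : ℕ)) i ≠ 0 := by
    rintro (n | n) <;> exact n.pos.ne'
  have hfin :
      {i : Gen | Sum.elim (fun n : ℕ+ => (n : ℕ)) (fun n : ℕ+ => (n : ℕ)) i ≤ N}.Finite := by
    have hN : {n : ℕ+ | (n : ℕ) ≤ N}.Finite :=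
      (Set.finite_Iic N).preimage PNat.coe_injective.injOn
    refine ((hN.image Sum.inl).union (hN.image Sum.inr)).subset ?_
    rintro (n | n) hn
    · exact Or.inl ⟨n, hn, rfl⟩
    · exact Or.inr ⟨n, hn, rfl⟩
  refine (Set.finite_Iic (∑ i ∈ hfin.toFinset, Finsupp.single i N)).subset fun m hm => ?_
  intro i
  by_cases hi : m i = 0
  · simp [hi]
  · have h1 : Sum.elim (fun n : ℕ+ => (n : ℕ)) (fun n : ℕ+ => (n : ℕ)) i ≤ N :=
      hm ▸ Finsupp.le_weight_of_ne_zero' _ hi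
    have h2 : m i ≤ N := hm ▸ Finsupp.le_weight _ (hw i) m
    rw [Finsupp.finsetSum_apply, Finset.sum_eq_single_of_mem i (by simpa using h1)
      fun j _ hj => Finsupp.single_eq_of_ne' hj]
    simpa using h2

/-- The quotient of two successive steps of the filtration embeds into a finite product of spaces
of modular forms, one for each monomial of the given weight and charge. -/
theorem finiteDimensional_step {Γ : Subgroup SL(2, ℤ)}
    (hΓ : CongruenceSubgroup.IsCongruenceSubgroup Γ) (N : ℕ) (w : ℤ)
    (ih : FiniteDimensional ℂ ↥(invariantsOfWeight Γ N ⊓ chargeLE (w - 1))) :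
    FiniteDimensional ℂ ↥(invariantsOfWeight Γ N ⊓ chargeLE w) := by
  have := hΓ.finiteIndex
  have hS := finite_conformalWeight_eq N
  let S : Type := {m : Gen →₀ ℕ // conformalWeight m = N ∧ charge m = w}
  have : Finite S :=
    (hS.subset fun m hm => hm.1 : {m | conformalWeight m = N ∧ charge m = w}.Finite)
  have := finiteDimensional_modularForm hΓ (-2 * w)
  let ι : ↥(invariantsOfWeight Γ N ⊓ chargeLE w) →ₗ[ℂ] ↥(invariants Γ ⊓ chargeLE w) :=
    Submodule.inclusion (inf_le_inf_right _ inf_le_left)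
  let φ := LinearMap.pi fun m : S => topCoeff Γ w m.1 m.2.2 ∘ₗ ι
  -- A vector without coefficients of charge `w` lies in the next step of the filtration.
  have hker : ∀ v : ↥(invariantsOfWeight Γ N ⊓ chargeLE w), v ∈ LinearMap.ker φ →
      v.1 ∈ invariantsOfWeight Γ N ⊓ chargeLE (w - 1) := by
    intro v hv
    refine ⟨v.2.1, fun m hm => ?_⟩
    have h1 : charge m ≤ w := v.2.2 m hm
    have h2 : charge m ≠ w := by
      intro h
      apply hm
      have h3 := congr_fun (LinearMap.mem_ker.mp hv) ⟨m, v.2.1.2 hm, h⟩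
      exact Hol.ext fun z => by
        have h4 := DFunLike.congr_fun h3 z
        simp only [Pi.zero_apply, zero_apply] at h4
        exact h4
    omega
  let ψ : LinearMap.ker φ →ₗ[ℂ] ↥(invariantsOfWeight Γ N ⊓ chargeLE (w - 1)) :=
    LinearMap.codRestrict _ (Submodule.subtype _ ∘ₗ (LinearMap.ker φ).subtype)
      fun v => hker v.1 v.2
  have : Module.Finite ℂ (LinearMap.ker φ) := Module.Finite.of_injective ψ fun x y hxy => by
    have h := congrArg Subtype.val hxy
    exact Subtype.ext (Subtype.ext h)
  refine Module.Finite.of_fg_top ?_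
  refine Submodule.fg_of_fg_map_of_fg_inf_ker φ (IsNoetherian.noetherian _) ?_
  rw [top_inf_eq]
  exact Module.Finite.iff_fg.mp this

/-- Induction over the finitely many charges which occur in conformal weight `N`. -/
theorem finiteDimensional_invariantsOfWeight {Γ : Subgroup SL(2, ℤ)}
    (hΓ : CongruenceSubgroup.IsCongruenceSubgroup Γ) (N : ℕ) :
    FiniteDimensional ℂ (invariantsOfWeight Γ N) := by
  have hfin := (finite_conformalWeight_eq N).image charge
  -- The filtration starts at `w₀ - 1` with the zero subspace and has reached everything at `w₁`.
  obtain ⟨w₀, h₀⟩ := hfin.bddBelow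
  obtain ⟨w₁, h₁⟩ := hfin.bddAbove
  have hstep : ∀ j : ℕ, FiniteDimensional ℂ ↥(invariantsOfWeight Γ N ⊓ chargeLE (w₀ - 1 + j)) := by
    intro j
    induction j with
    | zero =>
      have : invariantsOfWeight Γ N ⊓ chargeLE (w₀ - 1 + (0 : ℕ)) = ⊥ := by
        refine (Submodule.eq_bot_iff _).mpr fun v hv => MvPolynomial.ext _ _ fun m => ?_
        by_contra hm
        have h1 := hv.2 m hm
        have h2 := h₀ ⟨m, hv.1.2 hm, rfl⟩
        push_cast at h1
        omega
      rw [this]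
      infer_instance
    | succ j ih =>
      refine finiteDimensional_step hΓ N _ ?_
      have e : w₀ - 1 + ((j + 1 : ℕ) : ℤ) - 1 = w₀ - 1 + j := by
        push_cast
        ring
      rwa [e]
  have htop : invariantsOfWeight Γ N ⊓ chargeLE (w₀ - 1 + (w₁ - w₀ + 1).toNat) =
      invariantsOfWeight Γ N :=
    inf_eq_left.mpr fun v hv m hm => by
      have := h₁ ⟨m, hv.2 hm, rfl⟩
      omega
  exact htop ▸ hstep _

end ChiralDiffOp

end

theorem mainTheorem6 (Γ : Subgroup SL(2, ℤ)) (hΓ : CongruenceSubgroup.IsCongruenceSubgroup Γ)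
    (N : ℕ) :
    FiniteDimensional ℂ (ChiralDiffOp.invariantsOfWeight Γ N) := by
  exact ChiralDiffOp.finiteDimensional_invariantsOfWeight hΓ N
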